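/- \textbf{Setting.} Let $(\mathcal M,d)$ be a complete NPC space, i.e. a complete metric space such that any two points are joined by a geodesic ($\gamma:[0,1]\to\mathcal M$ with $d(\gamma(s),\gamma(t))=(t-s)\,d(\gamma(0),\gamma(1))$ for $0\le s\le t\le 1$) and such that, for every $p\in\mathcal M$, every geodesic $\gamma$ and every $t\in[0,1]$, \[d^2(p,\gamma(t))\le(1-t)\,d^2(p,\gamma(0))+t\,d^2(p,\gamma(1))-t(1-t)\,d^2(\gamma(0),\gamma(1)).\] Let $\mathcal Z$ be a measurable space and let $\ell:\mathcal M\times\mathcal Z\to\mathbb R$ be jointly measurable and such that, for every $z\in\mathcal Z$, $\ell(\cdot,z)$ is lower semicontinuous and geodesically convex (convex along every geodesic). Let $\Theta\subset\mathcal M$. A prediction strategy consists of a point $m_1\in\mathcal M$ and measurable maps $m_t:\mathcal Z^{t-1}\to\mathcal M$ for $t\ge2$. Suppose that, for numbers $B_T(q)\in[0,+\infty]$ indexed by $T\ge1$ and by the probability measures $q$ on $\Theta$, it satisfies \[\sum_{t=1}^T\ell\big(m_t(z_1,\dots,z_{t-1}),z_t\big)\le\inf_q\Big\{\int_\Theta\sum_{t=1}^T\ell(\theta,z_t)\,\mathrm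 dq(\theta)+B_T(q)\Big\}\] for all $T\ge1$ and all $(z_1,\dots,z_T)\in\mathcal Z^T$. Here and below, $\inf_q$ is over all probability measures $q$ on $\Theta$, and integrals and expectations take values in $[-\infty,+\infty]$, with value $+\infty$ if the positive part has infinite integral; measures $q$ with $B_T(q)=+\infty$ impose no constraint. Let $n\ge1$, let $Z_1,\dots,Z_n$ be i.i.d. $\mathcal Z$-valued random variables, and let $Z$ have the same distribution and be independent of $(Z_1,\dots,Z_n)$. Let $\theta_n$ be the barycenter of $\frac1{n+1}\sum_{i=1}^{n+1}\delta_{m_i(Z_1,\dots,Z_{i-1})}$, i.e. the minimizer over $m\in\mathcal M$ of $\sum_{i=1}^{n+1}d^2(m,m_i(Z_1,\dots,Z_{i-1}))$. Assume finally that, with $\ell^-=\max(-\ell,0)$, $\int_\Theta\mathbb E[\ell^-(\theta,Z)]\,\mathrm dq(\theta)<\infty$ for every probability measure $q$ on $\Theta$ and $\mathbb E[\ell^-(m_i(Z_1,\dots,Z_{i-1}),Z)]<\infty$ for $1\le i\le n+1$ (for instance, $\ell$ is nonnegative or bounded). \textbf{Theorem.} \begin{enumerate} \item \[\mathbb E[\ell(\theta_n,Z)]\le\inf_q\Big\{\int_\Theta\mathbb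 E[\ell(\theta,Z)]\,\mathrm dq(\theta)+\frac{B_{n+1}(q)}{n+1}\Big\}.\] \item If in addition there is $\lambda>0$ such that $\ell(\cdot,z)$ is $\lambda$-Lipschitz for every $z\in\mathcal Z$, then, for every $\theta^*\in\arg\min_{\theta\in\Theta}\mathbb E[\ell(\theta,Z)]$, \[\mathbb E[\ell(\theta_n,Z)]-\inf_{\theta\in\Theta}\mathbb E[\ell(\theta,Z)]\le\inf_q\Big\{\lambda\int_\Theta d(\theta^*,\theta)\,\mathrm dq(\theta)+\frac{B_{n+1}(q)}{n+1}\Big\},\] where the left-hand side is read as $-\infty$ if $\inf_{\theta\in\Theta}\mathbb E[\ell(\theta,Z)]=+\infty$. \end{enumerate} -/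

import Mathlib

open MeasureTheory ProbabilityTheory
open scoped ENNReal NNReal

/-- A constant speed geodesic parametrised by `[0, 1]`; only the values of `γ` on `[0, 1]` matter. -/
def IsGeodesic {M : Type*} [MetricSpace M] (γ : ℝ → M) : Prop :=
  ∀ s t : ℝ, 0 ≤ s → s ≤ t → t ≤ 1 → dist (γ s) (γ t) = (t - s) * dist (γ 0) (γ 1)

/-- An NPC space: a geodesic space with nonpositive curvature in the sense of Alexandrov. -/
structure IsNPC (M : Type*) [MetricSpace M] : Prop where
  exists_geodesic : ∀ x y : M, ∃ γ : ℝ → M, IsGeodesic γ ∧ γ 0 = x ∧ γ 1 = y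
  dist_sq_le : ∀ (p : M) (γ : ℝ → M), IsGeodesic γ → ∀ t ∈ Set.Icc (0 : ℝ) 1,
    dist p (γ t) ^ 2 ≤ (1 - t) * dist p (γ 0) ^ 2 + t * dist p (γ 1) ^ 2
      - t * (1 - t) * dist (γ 0) (γ 1) ^ 2

/-- Geodesic convexity: convexity along every geodesic. -/
def GeodesicallyConvex {M : Type*} [MetricSpace M] (f : M → ℝ) : Prop :=
  ∀ γ : ℝ → M, IsGeodesic γ → ConvexOn ℝ (Set.Icc (0 : ℝ) 1) (fun t => f (γ t))

/-- The class `𝒫₂(M)` of Borel probability measures with finite second moments. -/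
structure HasFiniteSecondMoment {M : Type*} [MetricSpace M] [MeasurableSpace M]
    (P : Measure M) : Prop where
  isProbabilityMeasure : IsProbabilityMeasure P
  integrable_dist_sq : ∀ x : M, Integrable (fun y => dist x y ^ 2) P

/-- `x` is a barycenter of `P ∈ 𝒫₂(M)`: a minimiser of `x ↦ ∫ d(x, y)² dP(y)`. -/
structure IsBarycenter {M : Type*} [MetricSpace M] [MeasurableSpace M]
    (P : Measure M) (x : M) : Prop where
  hasFiniteSecondMoment : HasFiniteSecondMoment P
  integral_le : ∀ y : M, ∫ u, dist x u ^ 2 ∂P ≤ ∫ u, dist y u ^ 2 ∂P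

open Classical in
/-- The integral with values in `[-∞, ∞]` of a measurable function, `∫ f⁺ - ∫ f⁻`.
It is `+∞` as soon as `∫ f⁺ = ∞`, in particular in the undefined case `∞ - ∞`. -/
noncomputable def extIntegral {α : Type*} [MeasurableSpace α] (μ : Measure α) (f : α → EReal) :
    EReal :=
  if ∫⁻ a, (f a).toENNReal ∂μ = ⊤ then ⊤
  else ((∫⁻ a, (f a).toENNReal ∂μ : ℝ≥0∞) : EReal) - ((∫⁻ a, (-f a).toENNReal ∂μ : ℝ≥0∞) : EReal)

/-- The first `t` terms of a finite sequence. -/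
def firstTerms {Z : Type*} {T : ℕ} (z : Fin T → Z) (t : ℕ) (ht : t ≤ T) : Fin t → Z :=
  fun j => z (Fin.castLE ht j)

/-- A prediction strategy with constant expert advice: `m t` is the prediction of round `t + 1`,
a function of the `t` outcomes that precede it (a constant if `t = 0`). -/
abbrev PredictionStrategy (M Z : Type*) := (t : ℕ) → (Fin t → Z) → M

/-- The cumulative loss `∑_{t = 1}^T ℓ(m_t(z_1, …, z_{t-1}), z_t)` of a strategy. -/
def cumulativeLoss {M Z : Type*} (ℓ : M → Z → ℝ) (m : PredictionStrategy M Z) {T : ℕ}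
    (z : Fin T → Z) : ℝ :=
  ∑ t : Fin T, ℓ (m t (firstTerms z t t.isLt.le)) (z t)

/-- `∑_{t=1}^T ℓ(m_t, z_t) ≤ inf_q {∫ ∑_{t=1}^T ℓ(θ, z_t) dq(θ) + B_T(q)}` for every `T ≥ 1` and
every outcome sequence, where `q` runs over the probability measures on `Θ`.
Those with `B_T(q) = ∞` do not constrain anything (in `EReal`, `-∞ + ∞` would be `-∞`). -/
def HasOnlineBound {M Z : Type*} [MeasurableSpace M] (ℓ : M → Z → ℝ) (Θ : Set M)
    (m : PredictionStrategy M Z) (B : ℕ → ProbabilityMeasure Θ → ℝ≥0∞) : Prop :=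
  ∀ T : ℕ, 1 ≤ T → ∀ z : Fin T → Z,
    ((cumulativeLoss ℓ m z : ℝ) : EReal) ≤
      ⨅ (q : ProbabilityMeasure Θ) (_ : B T q ≠ ⊤),
        (extIntegral (q : Measure Θ) (fun θ => ((∑ t : Fin T, ℓ θ (z t) : ℝ) : EReal))
          + (B T q : EReal))

/-- The probability measure `(n + 1)⁻¹ ∑_{i=1}^{n+1} δ_{m_i(z_1, …, z_{i-1})}` on `M`. -/
noncomputable def predictionMeasure {M Z : Type*} [MeasurableSpace M]
    (m : PredictionStrategy M Z) {n : ℕ} (z : Fin n → Z) : Measure M :=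
  ((n : ℝ≥0∞) + 1)⁻¹ •
    ∑ i : Fin (n + 1), Measure.dirac (m i (firstTerms z i (Nat.le_of_lt_succ i.isLt)))

/-! The theorem is an online-to-batch conversion, with geodesic averaging replaced by a barycenter.
Jensen's inequality (`IsNPC.card_mul_le_sum`) bounds the loss of the barycenter, for each outcome,
by the mean loss of the `n + 1` predictions. A prediction depends only on the past, and the next
outcome and `Z` are both independent of that past with the same law; so the expected loss is
unchanged when `Z` replaces the next outcome. Taking expectations in the online bound for the
sequence `Z₁, …, Zₙ, Z` and exchanging integrals by Fubini gives the first bound. The second follows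
by bounding the risk at `θ` by the risk at `θstar` plus `lam` times their distance.

Jensen is proved by a proximal argument with approximate minimisers: almost minimise `f + K d(b,
·)²`, move slightly from that point towards each `x i`, and sum; minimality of `b` cancels the
quadratic terms to first order. -/

/-! ### Jensen's inequality at barycenters. -/

/-- Jensen's inequality for finitely many points of an NPC space. -/
theorem IsNPC.card_mul_le_sum {M : Type*} [MetricSpace M] (hM : IsNPC M) {f : M → ℝ}
    (hlsc : LowerSemicontinuous f) (hconv : GeodesicallyConvex f)
    {ι : Type*} [Fintype ι] [Nonempty ι] (x : ι → M) {b : M}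
    (hb : ∀ y, ∑ i, dist b (x i) ^ 2 ≤ ∑ i, dist y (x i) ^ 2) :
    (Fintype.card ι : ℝ) * f b ≤ ∑ i, f (x i) := by
  by_contra! hlt
  have hN : (0 : ℝ) < Fintype.card ι := by exact_mod_cast Fintype.card_pos
  obtain ⟨c, hc1, hc2⟩ := exists_between ((div_lt_iff₀' hN).2 hlt)
  rw [div_lt_iff₀' hN] at hc1
  obtain ⟨r, hr, hball⟩ := Metric.eventually_nhds_iff.1 (hlsc b c hc2)
  have hδ : 0 < f b - c := sub_pos.2 hc2
  have convex_bound : ∀ (γ : ℝ → M), IsGeodesic γ → ∀ t ∈ Set.Icc (0 : ℝ) 1,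
      f (γ t) ≤ (1 - t) * f (γ 0) + t * f (γ 1) := by
    intro γ hγ t ht
    have := (hconv γ hγ).2 (Set.left_mem_Icc.2 zero_le_one) (Set.right_mem_Icc.2 zero_le_one)
      (sub_nonneg.2 ht.2) ht.1 (sub_add_cancel 1 t)
    simpa using this
  -- Since `f > c` at distance `r / 2` from `b`, convexity limits the decrease of `f` along a
  -- geodesic from `b` to slope `2 (f b - c) / r`. From distance `r` on, the penalty with this `K`
  -- compensates it.
  set K : ℝ := 2 * (f b - c) / r ^ 2 with hK
  have hK0 : 0 < K := by positivity
  set F : M → ℝ := fun y => f y + K * dist b y ^ 2 with hF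
  have far : ∀ y, r ≤ dist y b → f b ≤ F y := by
    intro y hy
    obtain ⟨γ, hγ, h0, h1⟩ := hM.exists_geodesic b y
    rw [dist_comm] at hy
    have hD : 0 < dist b y := hr.trans_le hy
    have ht0 : 0 < r / (2 * dist b y) := by positivity
    have ht1 : r / (2 * dist b y) ≤ 1 := by rw [div_le_one (by positivity)]; linarith
    have hd := hγ 0 _ le_rfl ht0.le ht1
    have hlow := hball (y := γ (r / (2 * dist b y))) (by
      rw [h0, h1] at hd
      rw [dist_comm, hd]
      have : (r / (2 * dist b y) - 0) * dist b y = r / 2 := by field_simp; ring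
      linarith)
    have hup := convex_bound γ hγ _ ⟨ht0.le, ht1⟩
    rw [h0, h1] at hup
    have h2 : -(f b - c) < r / (2 * dist b y) * (f y - f b) := by linarith
    have h3 : -(2 * dist b y / r * (f b - c)) < f y - f b := by
      have := mul_lt_mul_of_pos_left h2 (show 0 < 2 * dist b y / r by positivity)
      have e : 2 * dist b y / r * (r / (2 * dist b y) * (f y - f b)) = f y - f b := by
        field_simp
      linarith
    have h4 : 2 * dist b y / r * (f b - c) ≤ K * dist b y ^ 2 := by
      have e : K * dist b y ^ 2 = 2 * dist b y / r * (f b - c) * (dist b y / r) := by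
        rw [hK]; field_simp
      rw [e]
      exact le_mul_of_one_le_right (by positivity) ((one_le_div hr).2 hy)
    simp only [hF]; linarith
  have hFb : F b = f b := by simp [hF]
  have bdd : BddBelow (Set.range F) := by
    refine ⟨c, ?_⟩
    rintro _ ⟨y, rfl⟩
    rcases lt_or_ge (dist y b) r with h | h
    · have := hball h
      have : 0 ≤ K * dist b y ^ 2 := by positivity
      simp only [hF]; linarith
    · exact hc2.le.trans (far y h)
  -- An almost minimiser outside the ball can be replaced by `b` itself, by `far`.
  have almost_min : ∀ ε > 0, ∃ y, c < f y ∧ ∀ w, F y ≤ F w + ε := by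
    intro ε hε
    have : Nonempty M := ⟨b⟩
    obtain ⟨y, hy⟩ := exists_lt_of_ciInf_lt (lt_add_of_pos_right (⨅ w, F w) hε)
    have hy' : ∀ w, F y ≤ F w + ε := fun w => by
      have := ciInf_le bdd w
      linarith
    rcases lt_or_ge (dist y b) r with h | h
    · exact ⟨y, hball h, hy'⟩
    · exact ⟨b, hc2, fun w => (hFb.trans_le (far y h)).trans (hy' w)⟩
  set V : ℝ := ∑ i, dist b (x i) ^ 2 with hV
  have hV0 : 0 ≤ V := Finset.sum_nonneg fun i _ => sq_nonneg _
  set N : ℝ := (Fintype.card ι : ℝ) with hNdef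
  have hη : 0 < N * c - ∑ i, f (x i) := sub_pos.2 hc1
  have hden : 0 < N + K * V := by positivity
  -- With slack `t ^ 2` in the minimisation, the error after summing and dividing by `t` is `t * (N
  -- + K * V)`; this `t` keeps it within the gap.
  obtain ⟨t, ht0, ht1, ht2⟩ : ∃ t : ℝ, 0 < t ∧ t ≤ 1 ∧
      t * (N + K * V) ≤ N * c - ∑ i, f (x i) :=
    ⟨min 1 ((N * c - ∑ i, f (x i)) / (N + K * V)), lt_min one_pos (by positivity),
      min_le_left _ _, (le_div_iff₀ hden).1 (min_le_right _ _)⟩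
  obtain ⟨y, hcy, hy⟩ := almost_min (t ^ 2) (by positivity)
  -- Compare `F` at `y` with `F` at time `t` on the geodesic from `y` to `x i`.
  have hi : ∀ i, t * (f y - f (x i)) ≤ t ^ 2 + t * K *
      (dist b (x i) ^ 2 - (1 - t) * dist y (x i) ^ 2) := by
    intro i
    obtain ⟨γ, hγ, h0, h1⟩ := hM.exists_geodesic y (x i)
    have e1 := convex_bound γ hγ t ⟨ht0.le, ht1⟩
    have e2 := mul_le_mul_of_nonneg_left (hM.dist_sq_le b γ hγ t ⟨ht0.le, ht1⟩) hK0.le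
    have e3 := hy (γ t)
    rw [h0, h1] at e1 e2
    simp only [hF] at e3
    have e4 : 0 ≤ t * (K * dist b y ^ 2) := by positivity
    linarith
  have hsum := Finset.sum_le_sum fun i (_ : i ∈ Finset.univ) => hi i
  rw [← Finset.mul_sum, Finset.sum_add_distrib, ← Finset.mul_sum, Finset.sum_sub_distrib,
    Finset.sum_sub_distrib, ← Finset.mul_sum] at hsum
  simp only [Finset.sum_const, Finset.card_univ, nsmul_eq_mul] at hsum
  rw [← hV, ← hNdef] at hsum
  have h1 : t * K * (V - (1 - t) * ∑ i, dist y (x i) ^ 2) ≤ t * K * (V - (1 - t) * V) := by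
    have := mul_le_mul_of_nonneg_left (hb y) (sub_nonneg.2 ht1)
    exact mul_le_mul_of_nonneg_left (by linarith) (by positivity)
  have h2 : t * (N * f y - ∑ i, f (x i)) ≤ t * (t * (N + K * V)) := by
    linarith
  have h3 := le_of_mul_le_mul_left h2 ht0
  have h4 := mul_lt_mul_of_pos_left hcy hN
  linarith

theorem integral_dist_sq_predictionMeasure {M 𝒵 : Type*} [MetricSpace M] [MeasurableSpace M]
    [BorelSpace M] (m : PredictionStrategy M 𝒵) {n : ℕ} (z : Fin n → 𝒵) (y : M) :
    ∫ u, dist y u ^ 2 ∂(predictionMeasure m z) =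
      ((n : ℝ) + 1)⁻¹ *
        ∑ i : Fin (n + 1),
          dist y (m i (firstTerms z i (Nat.le_of_lt_succ i.isLt))) ^ 2 := by
  rw [predictionMeasure, integral_smul_measure, integral_finsetSum_measure]
  · simp [ENNReal.toReal_add]
  · intro i _
    exact integrable_dirac (by simp)

theorem IsBarycenter.predictionMeasure_le {M 𝒵 : Type*} [MetricSpace M] [MeasurableSpace M]
    [BorelSpace M] (hM : IsNPC M) {f : M → ℝ} (hlsc : LowerSemicontinuous f)
    (hconv : GeodesicallyConvex f) {m : PredictionStrategy M 𝒵} {n : ℕ} {z : Fin n → 𝒵} {b : M}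
    (hb : IsBarycenter (predictionMeasure m z) b) :
    f b ≤ ((n : ℝ) + 1)⁻¹ *
      ∑ i : Fin (n + 1), f (m i (firstTerms z i (Nat.le_of_lt_succ i.isLt))) := by
  have hn : (0 : ℝ) < n + 1 := by positivity
  have := hM.card_mul_le_sum hlsc hconv
    (fun i : Fin (n + 1) => m i (firstTerms z i (Nat.le_of_lt_succ i.isLt))) (b := b) fun y => by
      have h := hb.integral_le y
      rw [integral_dist_sq_predictionMeasure, integral_dist_sq_predictionMeasure] at h
      exact le_of_mul_le_mul_left h (by positivity)
  rw [inv_mul_eq_div, le_div_iff₀' hn]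
  simpa using this

/-! ### Extended integrals and integrability on products. -/

section ExtIntegral

variable {α β : Type*} [MeasurableSpace α] [MeasurableSpace β]

theorem extIntegral_mono_ae {μ : Measure α} {f g : α → EReal} (h : f ≤ᵐ[μ] g) :
    extIntegral μ f ≤ extIntegral μ g := by
  have hpos : ∫⁻ a, (f a).toENNReal ∂μ ≤ ∫⁻ a, (g a).toENNReal ∂μ :=
    lintegral_mono_ae (h.mono fun a ha => EReal.toENNReal_le_toENNReal ha)
  have hneg : ∫⁻ a, (-g a).toENNReal ∂μ ≤ ∫⁻ a, (-f a).toENNReal ∂μ :=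
    lintegral_mono_ae (h.mono fun a ha =>
      EReal.toENNReal_le_toENNReal (EReal.neg_le_neg_iff.2 ha))
  unfold extIntegral
  by_cases hg : ∫⁻ a, (g a).toENNReal ∂μ = ⊤
  · rw [if_pos hg]; exact le_top
  · rw [if_neg hg, if_neg (ne_top_of_le_ne_top hg hpos)]
    exact EReal.sub_le_sub (EReal.coe_ennreal_le_coe_ennreal_iff.2 hpos)
      (EReal.coe_ennreal_le_coe_ennreal_iff.2 hneg)

theorem extIntegral_congr_ae {μ : Measure α} {f g : α → EReal} (h : f =ᵐ[μ] g) :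
    extIntegral μ f = extIntegral μ g :=
  le_antisymm (extIntegral_mono_ae h.le) (extIntegral_mono_ae h.symm.le)

theorem extIntegral_coe {μ : Measure α} {f : α → ℝ} (hf : Integrable f μ) :
    extIntegral μ (fun a => (f a : EReal)) = ((∫ a, f a ∂μ : ℝ) : EReal) := by
  have hp : ∫⁻ a, ENNReal.ofReal (f a) ∂μ ≠ ⊤ := hf.lintegral_lt_top.ne
  have hn : ∫⁻ a, ENNReal.ofReal (-f a) ∂μ ≠ ⊤ := hf.neg.lintegral_lt_top.ne
  rw [extIntegral, if_neg (show ¬ ∫⁻ a, (f a : EReal).toENNReal ∂μ = ⊤ from hp)]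
  simp only [← EReal.coe_neg, EReal.real_coe_toENNReal]
  rw [integral_eq_lintegral_pos_part_sub_lintegral_neg_part hf, EReal.coe_sub,
    EReal.coe_ennreal_toReal hp, EReal.coe_ennreal_toReal hn]

theorem extIntegral_coe_map {μ : Measure α} {φ : α → β} (hφ : Measurable φ) {f : β → ℝ}
    (hf : Measurable f) :
    extIntegral (μ.map φ) (fun b => (f b : EReal)) =
      extIntegral μ (fun a => (f (φ a) : EReal)) := by
  have hp : ∫⁻ b, (f b : EReal).toENNReal ∂(μ.map φ) = ∫⁻ a, (f (φ a) : EReal).toENNReal ∂μ :=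
    lintegral_map hf.ennreal_ofReal hφ
  have hn : ∫⁻ b, (-(f b : EReal)).toENNReal ∂(μ.map φ) =
      ∫⁻ a, (-(f (φ a) : EReal)).toENNReal ∂μ :=
    lintegral_map hf.neg.ennreal_ofReal hφ
  simp only [extIntegral, hp, hn]

theorem extIntegral_ne_bot {μ : Measure α} {f : α → EReal}
    (h : ∫⁻ a, (-f a).toENNReal ∂μ ≠ ⊤) : extIntegral μ f ≠ ⊥ := by
  unfold extIntegral
  split_ifs with hp
  · exact top_ne_bot
  · lift (∫⁻ a, (f a).toENNReal ∂μ) to ℝ≥0 using hp with p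
    lift (∫⁻ a, (-f a).toENNReal ∂μ) to ℝ≥0 using h with k
    exact EReal.coe_ne_bot ((p : ℝ) - k)

theorem lintegral_toENNReal_le_extIntegral_add {μ : Measure α} (f : α → EReal) :
    ∫⁻ a, (f a).toENNReal ∂μ ≤ (extIntegral μ f).toENNReal + ∫⁻ a, (-f a).toENNReal ∂μ := by
  unfold extIntegral
  split_ifs with hp
  · simp
  · by_cases h : ∫⁻ a, (-f a).toENNReal ∂μ = ⊤
    · simp [h]
    · rw [EReal.toENNReal_sub (EReal.coe_ennreal_nonneg _)]
      simp only [EReal.toENNReal_coe]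
      exact le_tsub_add

theorem toENNReal_neg_extIntegral_le {μ : Measure α} (f : α → EReal) :
    (-extIntegral μ f).toENNReal ≤ ∫⁻ a, (-f a).toENNReal ∂μ := by
  unfold extIntegral
  split_ifs with hp
  · simp
  · rw [EReal.neg_sub (by simp) (by simp [hp]), add_comm, ← sub_eq_add_neg,
      EReal.toENNReal_sub (EReal.coe_ennreal_nonneg _)]
    simp

theorem integrable_of_lintegral_ofReal_ne_top {μ : Measure α} {f : α → ℝ}
    (hf : AEStronglyMeasurable f μ) (hp : ∫⁻ a, ENNReal.ofReal (f a) ∂μ ≠ ⊤)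
    (hn : ∫⁻ a, ENNReal.ofReal (-f a) ∂μ ≠ ⊤) : Integrable f μ := by
  refine ⟨hf, ?_⟩
  have : ∀ a, ‖f a‖ₑ ≤ ENNReal.ofReal (f a) + ENNReal.ofReal (-f a) := fun a => by
    rw [Real.enorm_eq_ofReal_abs]
    rcases abs_cases (f a) with h | h <;> rw [h.1]
    · exact le_self_add
    · exact le_add_self
  refine (lintegral_mono this).trans_lt ?_
  rw [lintegral_add_left' hf.aemeasurable.ennreal_ofReal]
  exact ENNReal.add_lt_top.2 ⟨hp.lt_top, hn.lt_top⟩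

variable {q : Measure α} {μ : Measure β} {f : α → β → ℝ}

theorem extIntegral_extIntegral_ne_bot
    (hneg : ∫⁻ a, ∫⁻ b, ENNReal.ofReal (-f a b) ∂μ ∂q ≠ ⊤) :
    extIntegral q (fun a => extIntegral μ fun b => (f a b : EReal)) ≠ ⊥ :=
  extIntegral_ne_bot <| ne_top_of_le_ne_top hneg <|
    lintegral_mono fun _ => toENNReal_neg_extIntegral_le _

/-- The inner positive part is at most the positive part of the inner extended integral plus the
inner negative part, and both have finite outer integral. This is what licenses Fubini. -/
theorem integrable_prod_of_extIntegral_ne_top [SFinite μ] (hf : Measurable (Function.uncurry f))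
    (hneg : ∫⁻ a, ∫⁻ b, ENNReal.ofReal (-f a b) ∂μ ∂q ≠ ⊤)
    (h : extIntegral q (fun a => extIntegral μ fun b => (f a b : EReal)) ≠ ⊤) :
    Integrable (Function.uncurry f) (q.prod μ) := by
  have hn : Measurable fun p : α × β => ENNReal.ofReal (-f p.1 p.2) := hf.neg.ennreal_ofReal
  have hp : Measurable fun p : α × β => ENNReal.ofReal (f p.1 p.2) := hf.ennreal_ofReal
  have hpos : ∫⁻ a, (extIntegral μ fun b => (f a b : EReal)).toENNReal ∂q ≠ ⊤ := by
    intro h'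
    exact h (by rw [extIntegral, if_pos h'])
  refine integrable_of_lintegral_ofReal_ne_top hf.aestronglyMeasurable ?_ ?_
  · change ∫⁻ p : α × β, ENNReal.ofReal (f p.1 p.2) ∂(q.prod μ) ≠ ⊤
    rw [lintegral_prod _ hp.aemeasurable]
    refine ne_top_of_le_ne_top ?_ (lintegral_mono fun a =>
      lintegral_toENNReal_le_extIntegral_add fun b => (f a b : EReal))
    simp only [← EReal.coe_neg, EReal.real_coe_toENNReal]
    rw [lintegral_add_right _ hn.lintegral_prod_right']
    exact ENNReal.add_ne_top.2 ⟨hpos, hneg⟩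
  · change ∫⁻ p : α × β, ENNReal.ofReal (-f p.1 p.2) ∂(q.prod μ) ≠ ⊤
    rwa [lintegral_prod _ hn.aemeasurable]

theorem extIntegral_extIntegral_eq_integral [SFinite q] [SFinite μ]
    (hf : Integrable (Function.uncurry f) (q.prod μ)) :
    extIntegral q (fun a => extIntegral μ fun b => (f a b : EReal)) =
      ((∫ a, ∫ b, f a b ∂μ ∂q : ℝ) : EReal) := by
  refine Eq.trans ?_ (extIntegral_coe hf.integral_prod_left)
  exact extIntegral_congr_ae (hf.prod_right_ae.mono fun a ha => extIntegral_coe ha)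

end ExtIntegral

/-! ### Online-to-batch conversion. -/

/-- Adding negative parts makes every summand nonnegative, so each one is dominated by the whole
sum, hence by `S` plus all the negative parts. -/
theorem integrable_of_sum_le {α ι : Type*} [MeasurableSpace α] [Fintype ι] {μ : Measure α}
    {c : ι → α → ℝ} {S : α → ℝ} (hc : ∀ i, AEStronglyMeasurable (c i) μ)
    (hneg : ∀ i, ∫⁻ a, ENNReal.ofReal (-c i a) ∂μ ≠ ⊤) (hS : Integrable S μ)
    (hle : ∀ᵐ a ∂μ, ∑ i, c i a ≤ S a) (i : ι) : Integrable (c i) μ := by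
  refine integrable_of_lintegral_ofReal_ne_top (hc i) ?_ (hneg i)
  have hmax : ∀ j, Integrable (fun a => max (-c j a) 0) μ := fun j => by
    refine integrable_of_lintegral_ofReal_ne_top
      ((hc j).aemeasurable.neg.max aemeasurable_const).aestronglyMeasurable ?_ ?_
    · simpa using hneg j
    · have : ∀ a, ENNReal.ofReal (-max (-c j a) 0) = 0 := fun a =>
        ENNReal.ofReal_of_nonpos (neg_nonpos.2 (le_max_right _ _))
      simp [this]
  have hU : Integrable (fun a => S a + ∑ j, max (-c j a) 0) μ :=
    hS.add (integrable_finsetSum _ fun j _ => hmax j)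
  refine ne_top_of_le_ne_top hU.lintegral_lt_top.ne (lintegral_mono_ae ?_)
  filter_upwards [hle] with a ha
  refine ENNReal.ofReal_le_ofReal ?_
  have h1 : c i a + max (-c i a) 0 ≤ ∑ j, (c j a + max (-c j a) 0) :=
    Finset.single_le_sum (f := fun j => c j a + max (-c j a) 0)
      (fun j _ => by have := le_max_left (-c j a) 0; linarith) (Finset.mem_univ i)
  rw [Finset.sum_add_distrib] at h1
  have := le_max_right (-c i a) 0
  linarith

theorem measurable_firstTerms {Ω 𝒵 : Type*} [MeasurableSpace Ω] [MeasurableSpace 𝒵] {T : ℕ}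
    {X : Fin T → Ω → 𝒵} (hX : ∀ i, Measurable (X i)) (t : ℕ) (ht : t ≤ T) :
    Measurable fun ω => firstTerms (fun i => X i ω) t ht :=
  measurable_pi_lambda _ fun j => hX (Fin.castLE ht j)

theorem identDistrib_firstTerms_prodMk {Ω 𝒵 : Type*} [MeasurableSpace Ω] [MeasurableSpace 𝒵]
    {P : Measure Ω} [IsProbabilityMeasure P] {n : ℕ} {Zs : Fin n → Ω → 𝒵} {Z : Ω → 𝒵}
    (hZs_meas : ∀ i, Measurable (Zs i))
    (hZs_indep : iIndepFun Zs P) (hZ_indep : IndepFun (fun ω i => Zs i ω) Z P)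
    (hZ_ident : ∀ i, IdentDistrib (Zs i) Z P P) (i : Fin n) :
    IdentDistrib (fun ω => (firstTerms (fun j => Zs j ω) i i.isLt.le, Zs i ω))
      (fun ω => (firstTerms (fun j => Zs j ω) i i.isLt.le, Z ω)) P P := by
  refine IdentDistrib.prodMk
    (.refl (measurable_firstTerms hZs_meas _ _).aemeasurable) (hZ_ident i) ?_ ?_
  · have hd : Disjoint (Finset.univ.filter fun j => j < i) {i} := by simp
    have hφ : Measurable fun (s : (Finset.univ.filter fun j => j < i) → 𝒵) (j : Fin i) =>
        s ⟨Fin.castLE i.isLt.le j, Finset.mem_filter.2 ⟨Finset.mem_univ _, j.isLt⟩⟩ :=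
      measurable_pi_lambda _ fun j => measurable_pi_apply _
    have hψ : Measurable fun s : ({i} : Finset (Fin n)) → 𝒵 => s ⟨i, Finset.mem_singleton_self i⟩ :=
      measurable_pi_apply _
    exact (hZs_indep.indepFun_finset _ _ hd hZs_meas).comp hφ hψ
  · exact hZ_indep.comp (φ := fun z => firstTerms z i i.isLt.le) (ψ := id)
      (measurable_pi_lambda _ fun j => measurable_pi_apply _) measurable_id

theorem integrable_loss_and_sum_integral_le
    {M : Type*} [MeasurableSpace M] {𝒵 : Type*} [MeasurableSpace 𝒵]
    {Ω : Type*} [MeasurableSpace Ω] {P : Measure Ω} [IsProbabilityMeasure P]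
    {ℓ : M → 𝒵 → ℝ} (hℓ_meas : Measurable (Function.uncurry ℓ)) {Θ : Set M}
    {m : PredictionStrategy M 𝒵} (hm : ∀ t, Measurable (m t))
    {B : ℕ → ProbabilityMeasure Θ → ℝ≥0∞} (hB : HasOnlineBound ℓ Θ m B)
    {n : ℕ} {Zs : Fin n → Ω → 𝒵} {Z : Ω → 𝒵}
    (hZs_meas : ∀ i, Measurable (Zs i)) (hZ_meas : Measurable Z)
    (hZs_indep : iIndepFun Zs P) (hZ_indep : IndepFun (fun ω i => Zs i ω) Z P)
    (hZ_ident : ∀ i, IdentDistrib (Zs i) Z P P)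
    (hint_m : ∀ (t : ℕ) (ht : t ≤ n),
      ∫⁻ ω, ENNReal.ofReal (-ℓ (m t (firstTerms (fun i => Zs i ω) t ht)) (Z ω)) ∂P ≠ ⊤)
    {q : ProbabilityMeasure Θ} (hq : B (n + 1) q ≠ ⊤)
    (hint : Integrable (Function.uncurry fun (θ : Θ) z => ℓ θ z)
      ((q : Measure Θ).prod (P.map Z))) :
    (∀ i : Fin (n + 1), Integrable (fun ω =>
      ℓ (m i (firstTerms (fun j => Zs j ω) i (Nat.le_of_lt_succ i.isLt))) (Z ω)) P) ∧
    ∑ i : Fin (n + 1), ∫ ω,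
      ℓ (m i (firstTerms (fun j => Zs j ω) i (Nat.le_of_lt_succ i.isLt))) (Z ω) ∂P ≤
      ((n : ℝ) + 1) * (∫ θ : Θ, ∫ z, ℓ θ z ∂(P.map Z) ∂(q : Measure Θ))
        + (B (n + 1) q).toReal := by
  have : IsProbabilityMeasure (P.map Z) := Measure.isProbabilityMeasure_map hZ_meas.aemeasurable
  -- `Z` serves as outcome `n + 1`, so that all `n + 1` predictions, the last of which uses the full
  -- batch, enter the online bound.
  let W : Fin (n + 1) → Ω → 𝒵 := Fin.snoc (α := fun _ => Ω → 𝒵) Zs Z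
  have hW_last : W (Fin.last n) = Z := Fin.snoc_last (α := fun _ => Ω → 𝒵) Z Zs
  have hW_cast : ∀ i : Fin n, W i.castSucc = Zs i := fun i =>
    Fin.snoc_castSucc (α := fun _ => Ω → 𝒵) Z Zs i
  have hW_meas : ∀ i, Measurable (W i) := fun i => by
    refine Fin.lastCases ?_ (fun i => ?_) i
    · rwa [hW_last]
    · rw [hW_cast]; exact hZs_meas i
  have hW_map : ∀ i, P.map (W i) = P.map Z := fun i => by
    refine Fin.lastCases ?_ (fun i => ?_) i
    · rw [hW_last]
    · rw [hW_cast]; exact (hZ_ident i).map_eq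
  have hW_first : ∀ ω (i : Fin (n + 1)), firstTerms (fun j => W j ω) i i.isLt.le =
      firstTerms (fun j => Zs j ω) i (Nat.le_of_lt_succ i.isLt) := fun ω i => by
    funext j
    exact congrFun (hW_cast (Fin.castLE (Nat.le_of_lt_succ i.isLt) j)) ω
  let pred (i : Fin (n + 1)) (ω : Ω) : M :=
    m i (firstTerms (fun j => Zs j ω) i (Nat.le_of_lt_succ i.isLt))
  have hu (i : ℕ) : Measurable fun p : (Fin i → 𝒵) × 𝒵 => ℓ (m i p.1) p.2 :=
    hℓ_meas.comp (((hm i).comp measurable_fst).prodMk measurable_snd)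
  have hfirst (i : Fin (n + 1)) :=
    measurable_firstTerms hZs_meas i (Nat.le_of_lt_succ i.isLt)
  have hid : ∀ i, IdentDistrib (fun ω => ℓ (pred i ω) (W i ω)) (fun ω => ℓ (pred i ω) (Z ω))
      P P := fun i => by
    refine Fin.lastCases ?_ (fun i => ?_) i
    · rw [hW_last]
      exact .refl ((hu n).comp ((hfirst (Fin.last n)).prodMk hZ_meas)).aemeasurable
    · rw [hW_cast]
      exact (identDistrib_firstTerms_prodMk hZs_meas hZs_indep hZ_indep hZ_ident i).comp (hu i)
  let g : 𝒵 → ℝ := fun z => ∫ θ : Θ, ℓ θ z ∂(q : Measure Θ)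
  have hg : Integrable g (P.map Z) := hint.integral_prod_right
  have hgW : ∀ i, Integrable (fun ω => g (W i ω)) P := fun i =>
    (show Integrable g (P.map (W i)) by rwa [hW_map]).comp_measurable (hW_meas i)
  have hgW_int : ∀ i, ∫ ω, g (W i ω) ∂P = ∫ z, g z ∂(P.map Z) := fun i => by
    rw [← hW_map i, integral_map (hW_meas i).aemeasurable]
    rw [hW_map i]; exact hg.aestronglyMeasurable
  let S : Ω → ℝ := fun ω => ∑ i, g (W i ω) + (B (n + 1) q).toReal
  have hS : Integrable S P :=
    (integrable_finsetSum _ fun i _ => hgW i).add (integrable_const _)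
  have hle : ∀ᵐ ω ∂P, ∑ i, ℓ (pred i ω) (W i ω) ≤ S ω := by
    have hae : ∀ᵐ ω ∂P, ∀ i, Integrable (fun θ : Θ => ℓ θ (W i ω)) (q : Measure Θ) :=
      ae_all_iff.2 fun i => by
        have h := hint.prod_left_ae
        rw [← hW_map i] at h
        exact ae_of_ae_map (hW_meas i).aemeasurable h
    filter_upwards [hae] with ω hω
    have h := (hB (n + 1) (Nat.le_add_left 1 n) fun j => W j ω).trans (iInf₂_le q hq)
    rw [extIntegral_coe (integrable_finsetSum _ fun i _ => hω i),
      integral_finsetSum _ fun i _ => hω i, ← EReal.coe_ennreal_toReal hq,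
      ← EReal.coe_add, EReal.coe_le_coe_iff, cumulativeLoss] at h
    simpa only [hW_first] using h
  -- Only negative parts are controlled by assumption, through equality in law; the online bound
  -- supplies the upper control.
  have hc_int : ∀ i, Integrable (fun ω => ℓ (pred i ω) (W i ω)) P :=
    integrable_of_sum_le (fun i => (hid i).aemeasurable_fst.aestronglyMeasurable) (fun i => by
      have h := ((hid i).comp (u := fun x : ℝ => ENNReal.ofReal (-x)) (by fun_prop)).lintegral_eq
      exact h.trans_ne (hint_m i (Nat.le_of_lt_succ i.isLt))) hS hle
  refine ⟨fun i => (hid i).integrable_snd (hc_int i), ?_⟩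
  calc ∑ i, ∫ ω, ℓ (pred i ω) (Z ω) ∂P
      = ∑ i, ∫ ω, ℓ (pred i ω) (W i ω) ∂P :=
        Finset.sum_congr rfl fun i _ => (hid i).integral_eq.symm
    _ = ∫ ω, ∑ i, ℓ (pred i ω) (W i ω) ∂P := (integral_finsetSum _ fun i _ => hc_int i).symm
    _ ≤ ∫ ω, S ω ∂P := integral_mono_ae (integrable_finsetSum _ fun i _ => hc_int i) hS hle
    _ = _ := by
      rw [integral_add (integrable_finsetSum _ fun i _ => hgW i) (integrable_const _),
        integral_finsetSum _ fun i _ => hgW i, Finset.sum_congr rfl fun i _ => hgW_int i,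
        integral_integral_swap hint]
      simp [g]

/-! ### The two risk bounds. -/

theorem mainTheorem3
    {M : Type*} [MetricSpace M] [CompleteSpace M] [MeasurableSpace M] [BorelSpace M]
    {𝒵 : Type*} [MeasurableSpace 𝒵]
    {Ω : Type*} [MeasurableSpace Ω] (P : Measure Ω) [IsProbabilityMeasure P]
    (hM : IsNPC M)
    (ℓ : M → 𝒵 → ℝ) (hℓ_meas : Measurable (Function.uncurry ℓ))
    (hℓ_lsc : ∀ z, LowerSemicontinuous (fun x => ℓ x z))
    (hℓ_conv : ∀ z, GeodesicallyConvex (fun x => ℓ x z))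
    (Θ : Set M)
    (m : PredictionStrategy M 𝒵) (hm : ∀ t, Measurable (m t))
    (B : ℕ → ProbabilityMeasure Θ → ℝ≥0∞)
    (hB : HasOnlineBound ℓ Θ m B)
    (n : ℕ) (hn : 1 ≤ n)
    -- the batch and the generic random variable
    (Zs : Fin n → Ω → 𝒵) (Z : Ω → 𝒵)
    (hZs_meas : ∀ i, Measurable (Zs i)) (hZ_meas : Measurable Z)
    (hZs_indep : iIndepFun Zs P)
    (hZ_indep : IndepFun (fun ω i => Zs i ω) Z P)
    (hZ_ident : ∀ i, IdentDistrib (Zs i) Z P P)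
    -- negative parts of the losses are integrable, for random experts and for the predictions
    (hint_Θ : ∀ q : ProbabilityMeasure Θ,
      ∫⁻ θ : Θ, ∫⁻ ω, ENNReal.ofReal (-ℓ θ (Z ω)) ∂P ∂(q : Measure Θ) ≠ ⊤)
    (hint_m : ∀ (t : ℕ) (ht : t ≤ n),
      ∫⁻ ω, ENNReal.ofReal (-ℓ (m t (firstTerms (fun i => Zs i ω) t ht)) (Z ω)) ∂P ≠ ⊤)
    -- the barycenter estimator
    (θn : (Fin n → 𝒵) → M)
    (hθn : ∀ z : Fin n → 𝒵, IsBarycenter (predictionMeasure m z) (θn z)) :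
    (extIntegral P (fun ω => (ℓ (θn (fun i => Zs i ω)) (Z ω) : EReal)) ≤
      ⨅ q : ProbabilityMeasure Θ,
        (extIntegral (q : Measure Θ) (fun θ => extIntegral P (fun ω => (ℓ θ (Z ω) : EReal)))
          + ((B (n + 1) q / ((n : ℝ≥0∞) + 1) : ℝ≥0∞) : EReal)))
    ∧
    (∀ lam : ℝ≥0, 0 < lam → (∀ z, LipschitzWith lam (fun x => ℓ x z)) →
      ∀ θstar : Θ,
        (∀ θ : Θ, extIntegral P (fun ω => (ℓ θstar (Z ω) : EReal)) ≤
          extIntegral P (fun ω => (ℓ θ (Z ω) : EReal))) →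
        extIntegral P (fun ω => (ℓ (θn (fun i => Zs i ω)) (Z ω) : EReal))
            - (⨅ θ : Θ, extIntegral P (fun ω => (ℓ θ (Z ω) : EReal))) ≤
          ⨅ q : ProbabilityMeasure Θ,
            (((lam * ∫⁻ θ : Θ, edist (θstar : M) (θ : M) ∂(q : Measure Θ) : ℝ≥0∞) : EReal)
              + ((B (n + 1) q / ((n : ℝ≥0∞) + 1) : ℝ≥0∞) : EReal))) := by
  have hμ : IsProbabilityMeasure (P.map Z) := Measure.isProbabilityMeasure_map hZ_meas.aemeasurable
  have hℓΘ : Measurable (Function.uncurry fun (θ : Θ) z => ℓ θ z) :=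
    hℓ_meas.comp ((measurable_subtype_coe.comp measurable_fst).prodMk measurable_snd)
  have hℓθ : ∀ x : M, Measurable (ℓ x) := fun x => hℓ_meas.comp measurable_prodMk_left
  have hmap : ∀ x : M, extIntegral P (fun ω => (ℓ x (Z ω) : EReal)) =
      extIntegral (P.map Z) fun z => (ℓ x z : EReal) := fun x =>
    (extIntegral_coe_map hZ_meas (hℓθ x)).symm
  have hneg : ∀ q : ProbabilityMeasure Θ,
      ∫⁻ θ : Θ, ∫⁻ z, ENNReal.ofReal (-ℓ θ z) ∂(P.map Z) ∂(q : Measure Θ) ≠ ⊤ := fun q => by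
    have : ∀ x : M, ∫⁻ z, ENNReal.ofReal (-ℓ x z) ∂(P.map Z) =
        ∫⁻ ω, ENNReal.ofReal (-ℓ x (Z ω)) ∂P := fun x =>
      lintegral_map (hℓθ x).neg.ennreal_ofReal hZ_meas
    simpa only [this] using hint_Θ q
  have hn1 : (0 : ℝ) < (n : ℝ) + 1 := by positivity
  have part1 : ∀ q : ProbabilityMeasure Θ,
      extIntegral P (fun ω => (ℓ (θn (fun i => Zs i ω)) (Z ω) : EReal)) ≤
        extIntegral (q : Measure Θ) (fun θ => extIntegral P (fun ω => (ℓ θ (Z ω) : EReal)))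
          + ((B (n + 1) q / ((n : ℝ≥0∞) + 1) : ℝ≥0∞) : EReal) := by
    intro q
    simp only [hmap]
    have hbot := extIntegral_extIntegral_ne_bot (hneg q)
    -- In `EReal`, `⊥ + ⊤ = ⊥`, so the infinite case is trivial only because `hbot` excludes `⊥`.
    by_cases hq : B (n + 1) q = ⊤
    · have : B (n + 1) q / ((n : ℝ≥0∞) + 1) = ⊤ := by
        rw [hq]; exact ENNReal.top_div_of_ne_top (by finiteness)
      rw [this, EReal.coe_ennreal_top, EReal.add_top_of_ne_bot hbot]
      exact le_top
    by_cases htop : extIntegral (q : Measure Θ)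
        (fun θ => extIntegral (P.map Z) fun z => (ℓ θ z : EReal)) = ⊤
    · rw [htop, EReal.top_add_of_ne_bot (EReal.coe_ennreal_ne_bot _)]
      exact le_top
    have hint := integrable_prod_of_extIntegral_ne_top hℓΘ (hneg q) htop
    obtain ⟨ha, hsum⟩ := integrable_loss_and_sum_integral_le hℓ_meas hm hB hZs_meas hZ_meas
      hZs_indep hZ_indep hZ_ident hint_m hq hint
    have hB_div : ((B (n + 1) q / ((n : ℝ≥0∞) + 1) : ℝ≥0∞) : EReal) =
        (((B (n + 1) q).toReal / ((n : ℝ) + 1) : ℝ) : EReal) := by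
      rw [← EReal.coe_ennreal_toReal
        (ENNReal.div_ne_top hq (by simp)), ENNReal.toReal_div,
        ENNReal.toReal_add (by simp) (by simp)]
      simp
    rw [extIntegral_extIntegral_eq_integral hint, hB_div, ← EReal.coe_add]
    -- Jensen is applied pointwise; monotonicity of the extended integral needs no measurability of
    -- `θn`.
    refine (extIntegral_mono_ae (.of_forall fun ω => EReal.coe_le_coe_iff.2
      ((hθn fun i => Zs i ω).predictionMeasure_le hM (hℓ_lsc (Z ω)) (hℓ_conv (Z ω))))).trans ?_
    rw [extIntegral_coe ((integrable_finsetSum _ fun i _ => ha i).const_mul _),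
      EReal.coe_le_coe_iff, integral_const_mul, integral_finsetSum _ fun i _ => ha i,
      inv_mul_le_iff₀ hn1]
    refine hsum.trans_eq ?_
    field_simp
  refine ⟨le_iInf part1, fun lam hlam hlip θstar hstar => le_iInf fun q => ?_⟩
  have hinf : (⨅ θ : Θ, extIntegral P (fun ω => (ℓ θ (Z ω) : EReal))) =
      extIntegral P (fun ω => (ℓ θstar (Z ω) : EReal)) :=
    le_antisymm (iInf_le _ θstar) (le_iInf hstar)
  rw [hinf]
  -- Here `x - ⊤ = ⊥` for every `x`, including `⊤`, which is the stated convention for infinite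
  -- minimal risk.
  by_cases htop : extIntegral P (fun ω => (ℓ θstar (Z ω) : EReal)) = ⊤
  · rw [htop, EReal.sub_top]
    exact bot_le
  -- A Dirac mass turns the condition on random experts into one at `θstar`.
  have hnegstar : ∫⁻ ω, ENNReal.ofReal (-ℓ θstar (Z ω)) ∂P ≠ ⊤ := by
    simpa using hint_Θ ⟨Measure.dirac θstar, inferInstance⟩
  have hstar_int : Integrable (fun ω => ℓ θstar (Z ω)) P := by
    refine integrable_of_lintegral_ofReal_ne_top
      ((hℓθ θstar).comp hZ_meas).aestronglyMeasurable (fun h => htop ?_) hnegstar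
    exact if_pos h
  by_cases hd : ∫⁻ θ : Θ, edist (θstar : M) (θ : M) ∂(q : Measure Θ) = ⊤
  · rw [hd, ENNReal.mul_top (by exact_mod_cast hlam.ne'), EReal.coe_ennreal_top,
      EReal.top_add_of_ne_bot (EReal.coe_ennreal_ne_bot _)]
    exact le_top
  have hd_meas : Measurable fun θ : Θ => dist (θstar : M) (θ : M) :=
    (continuous_const.dist continuous_id).measurable.comp measurable_subtype_coe
  have hd_int : Integrable (fun θ : Θ => dist (θstar : M) (θ : M)) (q : Measure Θ) := by
    refine ⟨hd_meas.aestronglyMeasurable, ?_⟩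
    simpa [HasFiniteIntegral, Real.enorm_eq_ofReal dist_nonneg, ← edist_dist] using
      lt_top_iff_ne_top.2 hd
  have hlint : ((lam * ∫⁻ θ : Θ, edist (θstar : M) (θ : M) ∂(q : Measure Θ) : ℝ≥0∞) : EReal) =
      ((∫ θ : Θ, lam * dist (θstar : M) (θ : M) ∂(q : Measure Θ) : ℝ) : EReal) := by
    rw [integral_const_mul, integral_eq_lintegral_of_nonneg_ae
      (.of_forall fun _ => dist_nonneg) hd_meas.aestronglyMeasurable]
    simp only [← edist_dist]
    rw [← EReal.coe_ennreal_toReal (ENNReal.mul_ne_top (by simp) hd), ENNReal.toReal_mul]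
    simp
  have hexp : extIntegral (q : Measure Θ) (fun θ => extIntegral P (fun ω => (ℓ θ (Z ω) : EReal)))
      ≤ ((∫ ω, ℓ θstar (Z ω) ∂P : ℝ) : EReal) +
        ((∫ θ : Θ, lam * dist (θstar : M) (θ : M) ∂(q : Measure Θ) : ℝ) : EReal) := by
    have hle : ∀ θ : Θ, extIntegral P (fun ω => (ℓ θ (Z ω) : EReal)) ≤
        (((∫ ω, ℓ θstar (Z ω) ∂P) + lam * dist (θstar : M) (θ : M) : ℝ) : EReal) := fun θ => by
      have e : ∫ ω, (ℓ θstar (Z ω) + lam * dist (θstar : M) (θ : M)) ∂P =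
          (∫ ω, ℓ θstar (Z ω) ∂P) + lam * dist (θstar : M) (θ : M) := by
        rw [integral_add hstar_int (integrable_const _)]; simp
      rw [← e]
      refine (extIntegral_mono_ae (.of_forall fun ω => EReal.coe_le_coe_iff.2 ?_)).trans_eq
        (extIntegral_coe (hstar_int.add (integrable_const (lam * dist (θstar : M) (θ : M)))))
      have := (le_abs_self _).trans ((hlip (Z ω)).dist_le_mul (θ : M) θstar)
      rw [dist_comm] at this
      linarith
    refine (extIntegral_mono_ae (.of_forall hle)).trans_eq ?_
    refine (extIntegral_coe ((integrable_const (∫ ω, ℓ θstar (Z ω) ∂P)).add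
      (hd_int.const_mul lam))).trans ?_
    rw [integral_add' (integrable_const _) (hd_int.const_mul _), EReal.coe_add]
    simp
  refine EReal.sub_le_of_le_add' ((part1 q).trans ?_)
  rw [hlint, extIntegral_coe hstar_int, ← add_assoc]
  gcongr
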